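/- Let $P$ be a polygon in the Euclidean plane with vertices $V_1,\dots,V_n$, $n\ge 6$ (indices modulo $n$), which is convex and generic, i.e. no three vertices are collinear and no four vertices lie on a common circle. A circle through three vertices of a polygon is called \emph{empty} if none of the other vertices of that polygon lies in its interior, and \emph{full} if all of the other vertices of that polygon lie in its interior. For a generic polygon $Q$ with at least four vertices, let $s_-(Q)$ (respectively $s_+(Q)$) be the number of vertices $W_i$ of $Q$ such that the circle through the three consecutive vertices $W_{i-1},W_i,W_{i+1}$ of $Q$ is empty (respectively full). Let $V_aV_b$ be a diagonal of $P$ that cuts $P$ into the two polygons $P_1=V_aV_{a+1}\cdots V_b$ and $P_2=V_bV_{b+1}\cdots V_a$, each having at least four vertices. The diagonal is called \emph{Delaunay} (respectively \emph{Anti-Delaunay}) if there is a third vertex $V_k$ of $P$ such that the circle through $V_a,V_b,V_k$ is empty (respectively full) with respect to $P$. If the diagonal $V_aV_b$ is Delaunay, then $$s_-(P)\ \ge\ s_-(P_1)+s_-(P_2)-2.$$ If the diagonal $V_aV_b$ is Anti-Delaunay, then $$s_+(P)\ \ge\ s_+(P_1)+s_+(P_2)-2.$$ -/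

import Mathlib

/-- The Euclidean plane. -/
abbrev Plane : Type := EuclideanSpace ℝ (Fin 2)

namespace Polygon

/-- A polygon is generic if no three of its vertices are collinear and no four of them
lie on a circle. In particular its vertices are pairwise distinct as soon as there are
at least three of them. -/
def IsGeneric {n : ℕ} (P : Polygon Plane n) : Prop :=
  (∀ i j k : Fin n, i ≠ j → i ≠ k → j ≠ k → ¬ Collinear ℝ {P i, P j, P k}) ∧
  (∀ i j k l : Fin n, i ≠ j → i ≠ k → i ≠ l → j ≠ k → j ≠ l → k ≠ l →
    ¬ EuclideanGeometry.Cospherical {P i, P j, P k, P l})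

/-- A polygon (with vertices listed in cyclic order, in either orientation) is convex if it
lies on one side of the line through each of its edges. When no three vertices are collinear,
every edge is then an edge of the convex hull of the vertices, so that the closed polygonal
curve is simple, and it is the boundary of that convex hull. -/
def IsConvex {n : ℕ} [NeZero n] (P : Polygon Plane n) : Prop :=
  ∀ i j k : Fin n, (affineSpan ℝ {P i, P (i + 1)}).WSameSide (P j) (P k)

/-- The circle through the vertices `i`, `j`, `k` is empty: it contains none of the other
vertices in its interior. -/
def IsEmptyCircle {n : ℕ} (P : Polygon Plane n) (i j k : Fin n) : Prop :=
  ∃ S : EuclideanGeometry.Sphere Plane, P i ∈ S ∧ P j ∈ S ∧ P k ∈ S ∧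
    ∀ m : Fin n, m ≠ i → m ≠ j → m ≠ k → P m ∉ Metric.ball S.center S.radius

/-- The circle through the vertices `i`, `j`, `k` is full: it contains all of the other
vertices in its interior. -/
def IsFullCircle {n : ℕ} (P : Polygon Plane n) (i j k : Fin n) : Prop :=
  ∃ S : EuclideanGeometry.Sphere Plane, P i ∈ S ∧ P j ∈ S ∧ P k ∈ S ∧
    ∀ m : Fin n, m ≠ i → m ≠ j → m ≠ k → P m ∈ Metric.ball S.center S.radius

/-- `s₋(P)`: the number of globally maximal-extremal vertices, i.e. of vertices `i` such that
the circle through the vertices `i - 1`, `i`, `i + 1` is empty. -/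
noncomputable def sMinus {n : ℕ} [NeZero n] (P : Polygon Plane n) : ℕ :=
  {i : Fin n | P.IsEmptyCircle (i - 1) i (i + 1)}.ncard

/-- `s₊(P)`: the number of globally minimal-extremal vertices, i.e. of vertices `i` such that
the circle through the vertices `i - 1`, `i`, `i + 1` is full. -/
noncomputable def sPlus {n : ℕ} [NeZero n] (P : Polygon Plane n) : ℕ :=
  {i : Fin n | P.IsFullCircle (i - 1) i (i + 1)}.ncard

/-- The edge or diagonal joining the vertices `a` and `b` is Delaunay: these two vertices lie
on an empty circle. -/
def IsDelaunay {n : ℕ} (P : Polygon Plane n) (a b : Fin n) : Prop :=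
  ∃ k : Fin n, k ≠ a ∧ k ≠ b ∧ P.IsEmptyCircle a b k

/-- The edge or diagonal joining the vertices `a` and `b` is Anti-Delaunay: these two vertices
lie on a full circle. -/
def IsAntiDelaunay {n : ℕ} (P : Polygon Plane n) (a b : Fin n) : Prop :=
  ∃ k : Fin n, k ≠ a ∧ k ≠ b ∧ P.IsFullCircle a b k

/-- The polygon with vertices `a, a + 1, …, b` (indices modulo `n`), closed up by the segment
from `b` to `a`. Cutting `P` along the diagonal `ab` gives the two polygons `P.cut a b` and
`P.cut b a`. The difference `b - a` is taken in `Fin n`, that is modulo `n`. -/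
def cut {n : ℕ} [NeZero n] (P : Polygon Plane n) (a b : Fin n) :
    Polygon Plane ((b - a).val + 1) where
  vertices j := P (a + Fin.ofNat n j.val)

end Polygon

/-! For circles `S` and `T`, the difference of the powers of a point is an affine function `f`. At
the vertices of a convex quadrilateral, `f` therefore satisfies a relation balancing one pair of
opposite corners against the other, all coefficients (brackets) having one sign
(`power_sub_power_relation`). Empty and full circles differ only by a sign `ε` on the power, so both
inequalities are one statement.

Two applications suffice. Let `S` be the extremal circle of a piece at a vertex off the diagonal and
`T` the Delaunay circle: since `ε * f` is nonnegative at both ends of the diagonal and nonpositive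
at that vertex, it cannot be negative beyond the diagonal, so `S` is extremal for all of `P`
(`power_pos_across_diagonal`). If instead both ends of the diagonal were extremal in one piece, `f`
would vanish at both and take opposite signs at two vertices on the same side, which is impossible
(`not_both_ears`). Each piece thus contributes at most one extremal vertex not inherited from `P`.
-/

open EuclideanGeometry

/-! ### Brackets and relations among points of the plane -/

/-- Twice the signed area of the triangle `x y z`. -/
def bracket (x y z : Plane) : ℝ :=
  (y 0 - x 0) * (z 1 - x 1) - (y 1 - x 1) * (z 0 - x 0)

theorem bracket_rotate (x y z : Plane) : bracket y z x = bracket x y z := by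
  simp only [bracket]; ring

theorem collinear_of_bracket_eq_zero {x y z : Plane} (h : bracket x y z = 0) :
    Collinear ℝ {x, y, z} := by
  by_cases hxy : y = x
  · subst hxy
    simpa using collinear_pair ℝ y z
  rw [collinear_iff_of_mem (p₀ := x) (by simp)]
  refine ⟨y - x, ?_⟩
  have key : ∃ r : ℝ, z = r • (y - x) + x := by
    simp only [bracket] at h
    by_cases h0 : y 0 - x 0 = 0
    · have h1 : y 1 - x 1 ≠ 0 := by
        intro h1
        apply hxy
        ext i
        fin_cases i
        · simpa using sub_eq_zero.mp h0
        · simpa using sub_eq_zero.mp h1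
      refine ⟨(z 1 - x 1) / (y 1 - x 1), ?_⟩
      have hz : z 0 - x 0 = 0 := by
        rw [h0] at h
        simpa [h1] using h
      ext i
      fin_cases i
      · simp [h0]; linarith
      · simp; field_simp; ring
    · refine ⟨(z 0 - x 0) / (y 0 - x 0), ?_⟩
      ext i
      fin_cases i
      · simp; field_simp; ring
      · simp; field_simp; linarith
  intro p hp
  simp only [Set.mem_insert_iff, Set.mem_singleton_iff] at hp
  rcases hp with rfl | rfl | rfl
  · exact ⟨0, by simp⟩
  · exact ⟨1, by simp⟩
  · simpa using key

theorem bracket_eq_zero_of_mem_affineSpan {x y p : Plane} (hp : p ∈ line[ℝ, x, y]) :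
    bracket x y p = 0 := by
  obtain ⟨r, rfl⟩ := mem_affineSpan_pair_iff_exists_lineMap_eq.1 hp
  simp [bracket, AffineMap.lineMap_apply]; ring

theorem bracket_mul_nonneg_of_wSameSide {x y p q : Plane}
    (h : line[ℝ, x, y].WSameSide p q) : 0 ≤ bracket x y p * bracket x y q := by
  obtain ⟨p₁, hp₁, q₁, hq₁, hr⟩ := h
  -- The base point may be any point of the line, so the bracket is a linear form in `u -ᵥ w`; on
  -- two vectors of one ray its values multiply to a nonnegative multiple of a square.
  have shift : ∀ u w : Plane, w ∈ line[ℝ, x, y] → bracket x y u =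
      (y 0 - x 0) * (u -ᵥ w) 1 - (y 1 - x 1) * (u -ᵥ w) 0 := by
    intro u w hw
    have := bracket_eq_zero_of_mem_affineSpan hw
    simp only [bracket, vsub_eq_sub, PiLp.sub_apply] at this ⊢
    linarith
  rw [shift p p₁ hp₁, shift q q₁ hq₁]
  obtain ⟨w, a, b, ha, hb, -, h₁, h₂⟩ := hr.exists_eq_smul
  rw [h₁, h₂]
  simp only [PiLp.smul_apply, smul_eq_mul]
  have : 0 ≤ a * b * ((y 0 - x 0) * w 1 - (y 1 - x 1) * w 0) ^ 2 := by positivity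
  linarith

/-- The Plücker relation for four vectors with a common origin. -/
theorem bracket_plucker (o u x y z : Plane) :
    bracket o u y * bracket o x z = bracket o u x * bracket o y z + bracket o u z * bracket o x y := by
  simp only [bracket]; ring

/-- The affine relation between four points, applied to the difference of the powers with
respect to two circles. -/
theorem power_sub_power_relation (S T : Sphere Plane) (w x y z : Plane) :
    bracket x y z * (S.power w - T.power w) + bracket w x z * (S.power y - T.power y) =
      bracket w y z * (S.power x - T.power x) + bracket w x y * (S.power z - T.power z) := by
  simp only [Sphere.power, bracket, EuclideanSpace.dist_sq_eq, Fin.sum_univ_two, Real.dist_eq, sq_abs]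
  ring

/-- Transitivity of the angular order around a vertex of a convex polygon. -/
theorem bracket_pos_of_edges {n : ℕ} {s : ℝ} {Q : ℕ → Plane}
    (h₁ : ∀ k, 2 ≤ k → k < n → 0 < s * bracket (Q 0) (Q 1) (Q k))
    (h₂ : ∀ k, 1 ≤ k → k + 1 < n → 0 < s * bracket (Q 0) (Q k) (Q (k + 1)))
    {j k : ℕ} (hj : 0 < j) (hjk : j < k) (hk : k < n) :
    0 < s * bracket (Q 0) (Q j) (Q k) := by
  rcases Nat.lt_or_ge 1 j with hj1 | hj1
  swap
  · obtain rfl : j = 1 := by omega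
    exact h₁ k hjk hk
  induction k, hjk using Nat.le_induction with
  | base => exact h₂ j hj hk
  | succ k hjk ih =>
    have ih := ih (by omega)
    have hx := h₁ j hj1 (by omega)
    have hy := h₁ k (by omega) (by omega)
    have hz := h₁ (k + 1) (by omega) hk
    have e := h₂ k (by omega) hk
    -- Plücker expresses the wanted bracket, times a positive one, through brackets already known to
    -- be positive.
    have key : (s * bracket (Q 0) (Q 1) (Q k)) * (s * bracket (Q 0) (Q j) (Q (k + 1))) =
        (s * bracket (Q 0) (Q 1) (Q j)) * (s * bracket (Q 0) (Q k) (Q (k + 1))) +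
        (s * bracket (Q 0) (Q 1) (Q (k + 1))) * (s * bracket (Q 0) (Q j) (Q k)) := by
      linear_combination s * s * bracket_plucker (Q 0) (Q 1) (Q j) (Q k) (Q (k + 1))
    have : 0 < (s * bracket (Q 0) (Q 1) (Q k)) * (s * bracket (Q 0) (Q j) (Q (k + 1))) := by
      rw [key]; positivity
    exact (pos_iff_pos_of_mul_pos this).mp hy

/-! ### Circles through the sign of the power -/

theorem power_eq_zero_of_mem {S : Sphere Plane} {x : Plane} (h : x ∈ S) : S.power x = 0 := by
  rw [Sphere.power, mem_sphere.mp h, sub_self]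

theorem mem_ball_iff_power_neg {S : Sphere Plane} {x y : Plane} (h : x ∈ S) :
    y ∈ Metric.ball S.center S.radius ↔ S.power y < 0 := by
  -- A `Sphere` may have negative radius; having a point on it rules this out.
  have hr : 0 ≤ S.radius := mem_sphere.mp h ▸ dist_nonneg
  rw [Metric.mem_ball, Sphere.power, sub_neg, sq_lt_sq₀ dist_nonneg hr]

theorem mem_of_power_eq_zero {S : Sphere Plane} {x y : Plane} (h : x ∈ S) (h0 : S.power y = 0) :
    y ∈ S := by
  have hr : 0 ≤ S.radius := mem_sphere.mp h ▸ dist_nonneg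
  rw [Sphere.power, sub_eq_zero, sq_eq_sq₀ dist_nonneg hr] at h0
  exact mem_sphere.mpr h0

namespace Polygon

variable {n : ℕ}

theorem IsGeneric.bracket_ne_zero {P : Polygon Plane n} (h : P.IsGeneric) {i j k : Fin n}
    (hij : i ≠ j) (hik : i ≠ k) (hjk : j ≠ k) : bracket (P i) (P j) (P k) ≠ 0 :=
  fun h0 => h.1 i j k hij hik hjk (collinear_of_bracket_eq_zero h0)

/-- The circle through the vertices `i`, `j`, `k` has all other vertices strictly outside
(for `ε = 1`) or strictly inside (for `ε = -1`). -/
def IsSignedCircle (ε : ℝ) (P : Polygon Plane n) (i j k : Fin n) : Prop :=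
  ∃ S : Sphere Plane, P i ∈ S ∧ P j ∈ S ∧ P k ∈ S ∧
    ∀ m : Fin n, m ≠ i → m ≠ j → m ≠ k → 0 < ε * S.power (P m)

theorem IsGeneric.power_ne_zero {P : Polygon Plane n} (hP : P.IsGeneric) {S : Sphere Plane}
    {i j k m : Fin n} (hi : P i ∈ S) (hj : P j ∈ S) (hk : P k ∈ S) (hij : i ≠ j) (hik : i ≠ k)
    (hjk : j ≠ k) (hmi : m ≠ i) (hmj : m ≠ j) (hmk : m ≠ k) : S.power (P m) ≠ 0 := by
  intro h0
  refine hP.2 i j k m hij hik hmi.symm hjk hmj.symm hmk.symm ⟨S.center, S.radius, ?_⟩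
  intro p hp
  simp only [Set.mem_insert_iff, Set.mem_singleton_iff] at hp
  rcases hp with rfl | rfl | rfl | rfl
  exacts [hi, hj, hk, mem_of_power_eq_zero hi h0]

theorem isFullCircle_iff {P : Polygon Plane n} {i j k : Fin n} :
    P.IsFullCircle i j k ↔ P.IsSignedCircle (-1) i j k := by
  refine exists_congr fun S => and_congr_right fun hi => and_congr_right fun _ =>
    and_congr_right fun _ => ?_
  simp only [mem_ball_iff_power_neg hi, neg_one_mul, neg_pos]

/-- Emptiness is a weak inequality; it becomes strict because no fourth vertex is concyclic. -/
theorem IsGeneric.isEmptyCircle_iff {P : Polygon Plane n} (hP : P.IsGeneric) {i j k : Fin n}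
    (hij : i ≠ j) (hik : i ≠ k) (hjk : j ≠ k) :
    P.IsEmptyCircle i j k ↔ P.IsSignedCircle 1 i j k := by
  refine exists_congr fun S => and_congr_right fun hi => and_congr_right fun hj =>
    and_congr_right fun hk => ?_
  simp only [mem_ball_iff_power_neg hi, one_mul, not_lt]
  exact forall_congr' fun m => forall_congr' fun hmi => forall_congr' fun hmj =>
    forall_congr' fun hmk => ⟨fun h => lt_of_le_of_ne h
      (hP.power_ne_zero hi hj hk hij hik hjk hmi hmj hmk).symm, le_of_lt⟩

theorem zero_le_power_of_separated {ε : ℝ} {P : Polygon Plane n} {S : Sphere Plane} {i j k : Fin n}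
    (hi : P i ∈ S) (hj : P j ∈ S) (hk : P k ∈ S)
    (h : ∀ m : Fin n, m ≠ i → m ≠ j → m ≠ k → 0 < ε * S.power (P m)) (m : Fin n) :
    0 ≤ ε * S.power (P m) := by
  by_cases hmi : m = i
  · rw [hmi, power_eq_zero_of_mem hi, mul_zero]
  by_cases hmj : m = j
  · rw [hmj, power_eq_zero_of_mem hj, mul_zero]
  by_cases hmk : m = k
  · rw [hmk, power_eq_zero_of_mem hk, mul_zero]
  exact (h m hmi hmj hmk).le

theorem IsSignedCircle.swap {ε : ℝ} {P : Polygon Plane n} {i j k : Fin n}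
    (h : P.IsSignedCircle ε i j k) : P.IsSignedCircle ε j i k := by
  obtain ⟨S, h₁, h₂, h₃, h₄⟩ := h
  exact ⟨S, h₂, h₁, h₃, fun m hmj hmi hmk => h₄ m hmi hmj hmk⟩

/-! ### Cyclic indices -/

/-- The vertices strictly between `a` and `b`. -/
def openArc (a b : Fin n) : Set (Fin n) :=
  {i | 0 < (i - a).val ∧ (i - a).val < (b - a).val}

theorem disjoint_openArc (a b : Fin n) : Disjoint (openArc a b) (openArc b a) := by
  rw [Set.disjoint_left]
  rintro i ⟨h₁, h₂⟩ ⟨h₃, h₄⟩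
  simp only [Fin.val_sub] at h₁ h₂ h₃ h₄
  have := a.isLt
  have := b.isLt
  have := i.isLt
  have mod : ∀ x y : Fin n, (n - y.val + x.val) % n =
      if y.val ≤ x.val then x.val - y.val else n - y.val + x.val := by
    intro x y
    have := x.isLt
    have := y.isLt
    split_ifs with hxy
    · rw [show n - y.val + x.val = (x.val - y.val) + n by omega, Nat.add_mod_right,
        Nat.mod_eq_of_lt (by omega)]
    · exact Nat.mod_eq_of_lt (by omega)
  rw [mod] at h₁ h₃
  rw [mod, mod] at h₂ h₄
  split_ifs at h₁ h₂ h₃ h₄ <;> omega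

variable [NeZero n]

/-- The vertices of `P`, numbered from `a`. -/
def shifted (P : Polygon Plane n) (a : Fin n) (k : ℕ) : Plane := P (a + Fin.ofNat n k)

theorem add_ofNat_succ (a : Fin n) (k : ℕ) :
    a + Fin.ofNat n (k + 1) = a + Fin.ofNat n k + 1 := by
  rw [add_assoc]
  congr 1
  ext
  simp [Fin.val_add]

theorem add_ofNat_injOn (a : Fin n) {j k : ℕ} (hj : j < n) (hk : k < n)
    (h : a + Fin.ofNat n j = a + Fin.ofNat n k) : j = k := by
  have := congrArg Fin.val (add_left_cancel h)
  simpa [Nat.mod_eq_of_lt hj, Nat.mod_eq_of_lt hk] using this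

theorem add_ofNat_val_sub (a i : Fin n) : a + Fin.ofNat n (i - a).val = i := by
  simp

theorem add_ofNat_sub_val (a : Fin n) {k : ℕ} (hk : k < n) :
    (a + Fin.ofNat n k - a).val = k := by
  simp [Nat.mod_eq_of_lt hk]

theorem add_ofNat_ne_add (a : Fin n) {k m : ℕ} (hm : 0 < m) (hmn : m < n) :
    a + Fin.ofNat n k ≠ a + Fin.ofNat n (k + m) := by
  intro h
  have := congrArg Fin.val (add_left_cancel h)
  simp only [Fin.val_ofNat] at this
  have h2 : (k + 0) ≡ (k + m) [MOD n] := this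
  have h3 := Nat.ModEq.add_left_cancel' k h2
  have := (Nat.modEq_iff_dvd' hm.le).mp h3
  exact absurd (Nat.le_of_dvd (by omega) this) (by omega)

/-! ### Orientation of a convex polygon -/

theorem bracket_mul_pos_of_isConvex {P : Polygon Plane n} (hP : P.IsGeneric) (hc : P.IsConvex)
    {i j k : Fin n} (hi : i ≠ i + 1) (hj : j ≠ i) (hj' : j ≠ i + 1) (hk : k ≠ i)
    (hk' : k ≠ i + 1) :
    0 < bracket (P i) (P (i + 1)) (P j) * bracket (P i) (P (i + 1)) (P k) :=
  lt_of_le_of_ne (bracket_mul_nonneg_of_wSameSide (hc i j k))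
    (mul_ne_zero (hP.bracket_ne_zero hi hj.symm hj'.symm)
      (hP.bracket_ne_zero hi hk.symm hk'.symm)).symm

/-- All triangles formed by vertices of a convex polygon in cyclic order have the same
orientation. -/
theorem exists_orientation {P : Polygon Plane n} (hn : 4 ≤ n) (hP : P.IsGeneric)
    (hc : P.IsConvex) (a : Fin n) :
    ∃ s : ℝ, ∀ i j k : ℕ, i < j → j < k → k < n →
      0 < s * bracket (P.shifted a i) (P.shifted a j) (P.shifted a k) := by
  have pos_trans : ∀ {x y z : ℝ}, 0 < x * y → 0 < y * z → 0 < x * z := by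
    intro x y z h₁ h₂
    have hy : y ≠ 0 := by rintro rfl; simp at h₁
    have : 0 < (x * z) * (y * y) := by
      have := mul_pos h₁ h₂; linarith
    exact (pos_iff_pos_of_mul_pos this).mpr (mul_self_pos.mpr hy)
  have edge : ∀ i : ℕ, ∀ j k : Fin n, j ≠ a + Fin.ofNat n i → j ≠ a + Fin.ofNat n (i + 1) →
      k ≠ a + Fin.ofNat n i → k ≠ a + Fin.ofNat n (i + 1) →
      0 < bracket (P.shifted a i) (P.shifted a (i + 1)) (P j) *
        bracket (P.shifted a i) (P.shifted a (i + 1)) (P k) := by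
    intro i j k hj hj' hk hk'
    have hi := add_ofNat_ne_add a (k := i) one_pos (by omega : 1 < n)
    rw [add_ofNat_succ] at hi hj' hk'
    rw [shifted, shifted, add_ofNat_succ]
    exact bracket_mul_pos_of_isConvex hP hc hi hj hj' hk hk'
  have ne₁ := fun k => add_ofNat_ne_add a (k := k) one_pos (by omega : 1 < n)
  have ne₂ := fun k => add_ofNat_ne_add a (k := k) two_pos (by omega : 2 < n)
  have ne₃ := fun k => add_ofNat_ne_add a (k := k) three_pos (by omega : 3 < n)
  refine ⟨bracket (P.shifted a 0) (P.shifted a 1) (P.shifted a 2), ?_⟩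
  set s := bracket (P.shifted a 0) (P.shifted a 1) (P.shifted a 2) with hs
  have consec : ∀ i : ℕ,
      0 < s * bracket (P.shifted a i) (P.shifted a (i + 1)) (P.shifted a (i + 2)) := by
    intro i
    induction i with
    | zero =>
      exact edge 0 (a + Fin.ofNat n 2) (a + Fin.ofNat n 2) (ne₂ 0).symm (ne₁ 1).symm (ne₂ 0).symm
        (ne₁ 1).symm
    | succ i ih =>
      -- Consecutive triples share the edge from `i + 1` to `i + 2`; vertices `i` and `i + 3` lie on
      -- the same side of it.
      rw [← bracket_rotate] at ih
      exact pos_trans ih (edge (i + 1) (a + Fin.ofNat n i) (a + Fin.ofNat n (i + 3)) (ne₁ i)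
        (ne₂ i) (ne₂ (i + 1)).symm (ne₁ (i + 2)).symm)
  have all : ∀ i : ℕ, ∀ k : Fin n, k ≠ a + Fin.ofNat n i → k ≠ a + Fin.ofNat n (i + 1) →
      0 < s * bracket (P.shifted a i) (P.shifted a (i + 1)) (P k) := fun i k hk hk' =>
    pos_trans (consec i) (edge i (a + Fin.ofNat n (i + 2)) k (ne₂ i).symm (ne₁ (i + 1)).symm hk hk')
  intro i j k hij hjk hk
  have inj : ∀ x y : ℕ, x < n → y < n → x ≠ y → a + Fin.ofNat n x ≠ a + Fin.ofNat n y :=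
    fun x y hx hy hxy h => hxy (add_ofNat_injOn a hx hy h)
  -- Vertex `i` serves as the common origin of the angular order.
  have := bracket_pos_of_edges (n := n - i) (s := s) (Q := fun m => P.shifted a (i + m))
    (j := j - i) (k := k - i)
    (fun m hm hmn => all i _ (inj _ _ (by omega) (by omega) (by omega))
      (inj _ _ (by omega) (by omega) (by omega)))
    (fun m hm hmn => by
      rw [← bracket_rotate]
      exact all (i + m) _ (inj _ _ (by omega) (by omega) (by omega))
        (inj _ _ (by omega) (by omega) (by omega)))
    (by omega) (by omega) (by omega)
  simpa [Nat.add_sub_cancel' hij.le, Nat.add_sub_cancel' (hij.trans hjk).le] using this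

/-! ### Comparing two circles -/

/-- If the ends of a diagonal lie on a circle separated from the other vertices, then a circle
through an interior vertex of one of the arcs, separated from the remaining vertices of that
arc, is separated from every vertex of the other arc that does not lie on it. -/
theorem power_pos_across_diagonal {s ε : ℝ} {w x y z : Plane} {S T : Sphere Plane}
    (h₁ : 0 < s * bracket x y z) (h₂ : 0 < s * bracket w x z) (h₃ : 0 < s * bracket w y z)
    (h₄ : 0 < s * bracket w x y) (hw : 0 ≤ ε * S.power w) (hy : 0 ≤ ε * S.power y)
    (hx : S.power x = 0) (hz : ε * S.power z ≠ 0)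
    (hTw : T.power w = 0) (hTy : T.power y = 0) (hTx : 0 ≤ ε * T.power x)
    (hTz : 0 ≤ ε * T.power z) : 0 < ε * S.power z := by
  by_contra hneg
  have hlt : ε * S.power z < 0 := lt_of_le_of_ne (not_lt.mp hneg) hz
  have rel := power_sub_power_relation S T w x y z
  have e₁ := mul_nonneg h₁.le hw
  have e₂ := mul_nonneg h₂.le hy
  have e₃ := mul_nonneg h₃.le hTx
  have e₄ := mul_pos h₄ (by linarith : 0 < ε * T.power z - ε * S.power z)
  rw [hx, hTw, hTy] at rel
  have rel' := congrArg (fun t => s * ε * t) rel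
  linarith

/-- The circles through the ends of a diagonal and through either of the adjacent vertices on one
side cannot both be separated from the respective other one. -/
theorem not_both_ears {s ε : ℝ} {w x y z : Plane} {S T : Sphere Plane}
    (h₂ : 0 < s * bracket w y z) (h₃ : 0 < s * bracket w x z)
    (hSw : S.power w = 0) (hSx : S.power x = 0) (hSz : S.power z = 0)
    (hTw : T.power w = 0) (hTy : T.power y = 0) (hTz : T.power z = 0)
    (hS : 0 < ε * S.power y) (hT : 0 < ε * T.power x) : False := by
  have rel := power_sub_power_relation S T w x y z
  rw [hSw, hSx, hSz, hTw, hTy, hTz] at rel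
  have e₁ := mul_pos h₃ hS
  have e₂ := mul_pos h₂ hT
  have rel' := congrArg (fun t => s * ε * t) rel
  linarith

/-! ### Ears of the two pieces -/

theorem shifted_zero (P : Polygon Plane n) (a : Fin n) : P.shifted a 0 = P a := by
  simp [shifted]

theorem shifted_val_sub (P : Polygon Plane n) (a b : Fin n) :
    P.shifted a (b - a).val = P b := by
  rw [shifted, add_ofNat_val_sub]

theorem cut_apply (P : Polygon Plane n) (a b : Fin n) (j : Fin ((b - a).val + 1)) :
    P.cut a b j = P.shifted a j.val := rfl

theorem fin_sub_one_val {d : ℕ} {j : Fin (d + 1)} (h : 0 < j.val) : (j - 1).val = j.val - 1 :=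
  Fin.val_sub_one_of_ne_zero (Fin.pos_iff_ne_zero.mp (Fin.lt_def.mpr (by simpa using h)))

theorem fin_add_one_val {d : ℕ} {j : Fin (d + 1)} (h : j.val < d) : (j + 1).val = j.val + 1 :=
  Fin.val_add_one_of_lt (Fin.lt_def.mpr (by simpa using h))

/-- An ear of a cut-off polygon away from the diagonal is an ear of the whole polygon. -/
theorem isSignedCircle_of_cut {ε : ℝ} (hε : ε ≠ 0) {P : Polygon Plane n} (hn : 4 ≤ n)
    (hP : P.IsGeneric) (hc : P.IsConvex) {a b k : Fin n} (hk : P.IsSignedCircle ε a b k)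
    {j : Fin ((b - a).val + 1)} (hj₀ : 0 < j.val) (hjd : j.val < (b - a).val)
    (hj : (P.cut a b).IsSignedCircle ε (j - 1) j (j + 1)) :
    P.IsSignedCircle ε (a + Fin.ofNat n j.val - 1) (a + Fin.ofNat n j.val)
      (a + Fin.ofNat n j.val + 1) := by
  obtain ⟨s, hs⟩ := exists_orientation hn hP hc a
  obtain ⟨T, hTa, hTb, hTk, hT⟩ := hk
  obtain ⟨S, hS₁, hS₂, hS₃, hS⟩ := hj
  have hS' := zero_le_power_of_separated hS₁ hS₂ hS₃ hS
  have hT' := zero_le_power_of_separated hTa hTb hTk hT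
  have hdn := (b - a).isLt
  have e₁ : a + Fin.ofNat n j.val - 1 = a + Fin.ofNat n (j.val - 1) := by
    obtain ⟨i, hi⟩ := Nat.exists_eq_succ_of_ne_zero hj₀.ne'
    rw [hi, Nat.succ_eq_add_one, add_ofNat_succ, Nat.add_sub_cancel, add_sub_cancel_right]
  rw [e₁, ← add_ofNat_succ]
  rw [cut_apply, fin_sub_one_val hj₀] at hS₁
  rw [cut_apply] at hS₂
  rw [cut_apply, fin_add_one_val hjd] at hS₃
  refine ⟨S, hS₁, hS₂, hS₃, fun m hm₁ hm₂ hm₃ => ?_⟩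
  have hm : a + Fin.ofNat n (m - a).val = m := add_ofNat_val_sub a m
  have ne : ∀ i, m ≠ a + Fin.ofNat n i → (m - a).val ≠ i := fun i h h' => h (by rw [← h', hm])
  have hv₁ := ne _ hm₁
  have hv₂ := ne _ hm₂
  have hv₃ := ne _ hm₃
  have hvn := (m - a).isLt
  rw [← shifted_val_sub P a m]
  rcases Nat.lt_or_ge (b - a).val (m - a).val with hv | hv
  · have inj : ∀ x y : ℕ, x < n → y < n → x ≠ y → a + Fin.ofNat n x ≠ a + Fin.ofNat n y :=
      fun x y hx hy hxy h => hxy (add_ofNat_injOn a hx hy h)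
    have h0 := hS' 0
    have hd := hS' (Fin.last _)
    rw [cut_apply] at h0 hd
    -- The quadrilateral is `a`, the ear, `b`, and `m` beyond the diagonal, in cyclic order.
    refine power_pos_across_diagonal (hs j.val (b - a).val (m - a).val hjd hv hvn)
      (hs 0 j.val (m - a).val hj₀ (hjd.trans hv) hvn)
      (hs 0 (b - a).val (m - a).val (hj₀.trans hjd) hv hvn)
      (hs 0 j.val (b - a).val hj₀ hjd hdn) (T := T) h0 hd (power_eq_zero_of_mem hS₂) ?_ ?_ ?_
      (hT' _) (hT' _)
    · refine mul_ne_zero hε (hP.power_ne_zero hS₁ hS₂ hS₃ ?_ ?_ ?_ ?_ ?_ ?_) <;>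
        exact inj _ _ (by omega) (by omega) (by omega)
    · rw [shifted_zero]; exact power_eq_zero_of_mem hTa
    · rw [shifted_val_sub]; exact power_eq_zero_of_mem hTb
  · have := hS ⟨(m - a).val, by omega⟩
    rw [cut_apply] at this
    refine this ?_ ?_ ?_ <;> rw [Ne, Fin.ext_iff]
    · rwa [fin_sub_one_val hj₀]
    · exact hv₂
    · rwa [fin_add_one_val hjd]

/-- The two ends of the diagonal are not both ears of the cut-off polygon. -/
theorem not_isSignedCircle_cut_ends {ε : ℝ} {P : Polygon Plane n} (hn : 4 ≤ n)
    (hP : P.IsGeneric) (hc : P.IsConvex) {a b : Fin n} (h : 4 ≤ (b - a).val + 1)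
    (h₀ : (P.cut a b).IsSignedCircle ε (0 - 1) 0 (0 + 1))
    (hd : (P.cut a b).IsSignedCircle ε (Fin.last _ - 1) (Fin.last _) (Fin.last _ + 1)) :
    False := by
  obtain ⟨s, hs⟩ := exists_orientation hn hP hc a
  have hdn := (b - a).isLt
  have v₁ : ((0 : Fin ((b - a).val + 1)) - 1).val = (b - a).val := by
    rw [← Fin.last_add_one, add_sub_cancel_right, Fin.val_last]
  have v₂ : ((0 : Fin ((b - a).val + 1)) + 1).val = 1 := by
    rw [fin_add_one_val (by rw [Fin.val_zero]; omega), Fin.val_zero]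
  have v₃ : ((Fin.last (b - a).val) - 1).val = (b - a).val - 1 := by
    rw [fin_sub_one_val (by rw [Fin.val_last]; omega), Fin.val_last]
  have v₄ : ((Fin.last (b - a).val) + 1).val = 0 := by simp
  obtain ⟨S, hS₁, hS₂, hS₃, hS⟩ := h₀
  obtain ⟨T, hT₁, hT₂, hT₃, hT⟩ := hd
  -- Each circle is tested at the other end's inner neighbour; these neighbours differ because the
  -- piece has at least four vertices.
  have hS := hS ⟨(b - a).val - 1, by omega⟩ (by rw [Ne, Fin.ext_iff, v₁]; dsimp only; omega)
    (by rw [Ne, Fin.ext_iff, Fin.val_zero]; dsimp only; omega) (by rw [Ne, Fin.ext_iff, v₂]; simp; omega)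
  have hT := hT ⟨1, by omega⟩ (by rw [Ne, Fin.ext_iff, v₃]; simp; omega)
    (by rw [Ne, Fin.ext_iff]; simp; omega) (by rw [Ne, Fin.ext_iff, v₄]; simp)
  rw [cut_apply] at hS₁ hS₂ hS₃ hT₁ hT₂ hT₃ hS hT
  rw [v₁] at hS₁
  rw [v₂] at hS₃
  rw [v₃] at hT₁
  rw [v₄] at hT₃
  exact not_both_ears (hs 0 ((b - a).val - 1) (b - a).val (by omega) (by omega) hdn)
    (hs 0 1 (b - a).val (by omega) (by omega) hdn)
    (power_eq_zero_of_mem hS₂) (power_eq_zero_of_mem hS₃) (power_eq_zero_of_mem hS₁)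
    (power_eq_zero_of_mem hT₃) (power_eq_zero_of_mem hT₁) (power_eq_zero_of_mem hT₂) hS hT

/-! ### Counting -/

/-- The vertices whose circle with the two neighbouring vertices is separated from the others. -/
def signedEars (ε : ℝ) (P : Polygon Plane n) : Set (Fin n) :=
  {i | P.IsSignedCircle ε (i - 1) i (i + 1)}

/-- Ears off the diagonal inject into ears of `P` on the open arc; the `+ 1` pays for the single end
that may be an ear. -/
theorem ncard_signedEars_cut_le {ε : ℝ} (hε : ε ≠ 0) {P : Polygon Plane n} (hn : 4 ≤ n)
    (hP : P.IsGeneric) (hc : P.IsConvex) {a b k : Fin n} (hk : P.IsSignedCircle ε a b k)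
    (h : 4 ≤ (b - a).val + 1) :
    ((P.cut a b).signedEars ε).ncard ≤ (P.signedEars ε ∩ openArc a b).ncard + 1 := by
  set E := (P.cut a b).signedEars ε with hE
  have hdn := (b - a).isLt
  have hends : (E ∩ {0, Fin.last _}).ncard ≤ 1 := by
    rw [Set.ncard_le_one]
    rintro x ⟨hxE, rfl | rfl⟩ y ⟨hyE, rfl | rfl⟩
    · rfl
    · exact (not_isSignedCircle_cut_ends hn hP hc h hxE hyE).elim
    · exact (not_isSignedCircle_cut_ends hn hP hc h hyE hxE).elim
    · rfl
  have hint : (E \ {0, Fin.last _}).ncard ≤ (P.signedEars ε ∩ openArc a b).ncard := by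
    refine Set.ncard_le_ncard_of_injOn (fun j => a + Fin.ofNat n j.val) ?_ ?_
    · rintro j ⟨hjE, hj⟩
      simp only [Set.mem_insert_iff, Set.mem_singleton_iff, not_or, Fin.ext_iff, Fin.val_zero,
        Fin.val_last] at hj
      have := j.isLt
      refine ⟨isSignedCircle_of_cut hε hn hP hc hk (by omega) (by omega) hjE, ?_⟩
      rw [openArc, Set.mem_ofPred_eq, add_ofNat_sub_val a (by omega)]
      omega
    · intro i _ j _ hij
      have := i.isLt
      have := j.isLt
      exact Fin.ext (add_ofNat_injOn a (by omega) (by omega) hij)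
  have := Set.ncard_inter_add_ncard_sdiff_eq_ncard E {0, Fin.last _}
  omega

/-- Cutting along a diagonal whose ends lie on a circle separated from the other vertices creates
at most two new ears. -/
theorem ncard_signedEars_cut_add_le {ε : ℝ} (hε : ε ≠ 0) {P : Polygon Plane n} (hn : 4 ≤ n)
    (hP : P.IsGeneric) (hc : P.IsConvex) {a b k : Fin n} (hk : P.IsSignedCircle ε a b k)
    (h₁ : 4 ≤ (b - a).val + 1) (h₂ : 4 ≤ (a - b).val + 1) :
    ((P.cut a b).signedEars ε).ncard + ((P.cut b a).signedEars ε).ncard ≤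
      (P.signedEars ε).ncard + 2 := by
  have e₁ := ncard_signedEars_cut_le hε hn hP hc hk h₁
  have e₂ := ncard_signedEars_cut_le hε hn hP hc hk.swap h₂
  have e₃ : (P.signedEars ε ∩ openArc a b).ncard + (P.signedEars ε ∩ openArc b a).ncard ≤
      (P.signedEars ε).ncard := by
    rw [← Set.ncard_union_eq ((disjoint_openArc a b).mono Set.inter_subset_right
      Set.inter_subset_right)]
    exact Set.ncard_le_ncard (Set.union_subset Set.inter_subset_left Set.inter_subset_left)
  omega

theorem IsGeneric.cut {P : Polygon Plane n} (hP : P.IsGeneric) (a b : Fin n) :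
    (P.cut a b).IsGeneric := by
  have inj : ∀ {i j : Fin ((b - a).val + 1)}, i ≠ j →
      a + Fin.ofNat n i.val ≠ a + Fin.ofNat n j.val := fun {i j} hij h => by
    have := (b - a).isLt
    have := i.isLt
    have := j.isLt
    exact hij (Fin.ext (add_ofNat_injOn a (by omega) (by omega) h))
  exact ⟨fun i j k hij hik hjk => hP.1 _ _ _ (inj hij) (inj hik) (inj hjk),
    fun i j k l hij hik hil hjk hjl hkl => hP.2 _ _ _ _ (inj hij) (inj hik) (inj hil) (inj hjk)
      (inj hjl) (inj hkl)⟩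

theorem sPlus_eq (P : Polygon Plane n) : P.sPlus = (P.signedEars (-1)).ncard := by
  simp only [sPlus, signedEars, isFullCircle_iff]

theorem IsGeneric.sMinus_eq {P : Polygon Plane n} (hP : P.IsGeneric) (hn : 3 ≤ n) :
    P.sMinus = (P.signedEars 1).ncard := by
  have ne₁ := fun i : Fin n => add_ofNat_ne_add (i - 1) (k := 0) one_pos (by omega : 1 < n)
  have ne₂ := fun i : Fin n => add_ofNat_ne_add (i - 1) (k := 0) two_pos (by omega : 2 < n)
  have ne₃ := fun i : Fin n => add_ofNat_ne_add (i - 1) (k := 1) one_pos (by omega : 1 < n)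
  have z : ∀ i : Fin n, i - 1 + Fin.ofNat n 0 = i - 1 := fun i => by simp
  have o : ∀ i : Fin n, i - 1 + Fin.ofNat n 1 = i := fun i => by
    rw [← Nat.zero_add 1, add_ofNat_succ, z, sub_add_cancel]
  have t : ∀ i : Fin n, i - 1 + Fin.ofNat n 2 = i + 1 := fun i => by
    rw [show 2 = 1 + 1 from rfl, add_ofNat_succ, o]
  simp only [Nat.reduceAdd, Nat.zero_add, z, o, t] at ne₁ ne₂ ne₃
  rw [sMinus, signedEars]
  congr 1
  ext i
  exact hP.isEmptyCircle_iff (ne₁ i) (ne₂ i) (ne₃ i)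

end Polygon

theorem mainTheorem1 {n : ℕ} [NeZero n] (hn : 6 ≤ n) (P : Polygon Plane n)
    (hgen : P.IsGeneric) (hconv : P.IsConvex) (a b : Fin n)
    (h₁ : 4 ≤ (b - a).val + 1) (h₂ : 4 ≤ (a - b).val + 1) :
    (P.IsDelaunay a b →
      (P.sMinus : ℤ) ≥ ((P.cut a b).sMinus : ℤ) + ((P.cut b a).sMinus : ℤ) - 2) ∧
    (P.IsAntiDelaunay a b →
      (P.sPlus : ℤ) ≥ ((P.cut a b).sPlus : ℤ) + ((P.cut b a).sPlus : ℤ) - 2) := by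
  have hab : a ≠ b := by rintro rfl; simp at h₁
  constructor
  · rintro ⟨k, hka, hkb, hk⟩
    rw [hgen.isEmptyCircle_iff hab hka.symm hkb.symm] at hk
    rw [hgen.sMinus_eq (by omega), (hgen.cut a b).sMinus_eq (by omega),
      (hgen.cut b a).sMinus_eq (by omega)]
    have := Polygon.ncard_signedEars_cut_add_le one_ne_zero (by omega) hgen hconv hk h₁ h₂
    omega
  · rintro ⟨k, -, -, hk⟩
    rw [Polygon.isFullCircle_iff] at hk
    rw [P.sPlus_eq, (P.cut a b).sPlus_eq, (P.cut b a).sPlus_eq]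
    have := Polygon.ncard_signedEars_cut_add_le (neg_ne_zero.mpr one_ne_zero) (by omega) hgen
      hconv hk h₁ h₂
    omega
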